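/- **Theorem 1.5 (Chaoticity).** For $N\ge 2$ let $D_N=\{x\in\mathbb C^N: x_i\ne x_j \text{ for } i\neq j\}$ and, for $x\in D_N$, $$H_N(x)=\frac1N\sum_{i=1}^N|x_i|^2+\frac1{2N^2}\sum_{i\ne j}\log\frac1{|x_i-x_j|^2}.$$ Let $\beta_N=N^2$, and let $P^N$ be the Boltzmann–Gibbs measure on $\mathbb C^N$ whose density with respect to Lebesgue measure is $Z_N^{-1}e^{-\beta_N H_N}$ on $D_N$ and $0$ outside $D_N$, where $Z_N=\int_{D_N}e^{-\beta_N H_N(x)}\,dx$. This is a probability measure (the complex Ginibre ensemble). For $1\le k\le N$ let $P^{k,N}$ be the law of the first $k$ coordinates under $P^N$; it has density $$\varphi^{k,N}(z_1,\dots,z_k)=\int_{\mathbb C^{N-k}}\frac{dP^N}{dz_1\cdots dz_N}(z_1,\dots,z_N)\,dz_{k+1}\cdots dz_N ,$$ where $\frac{dP^N}{dz_1\cdots dz_N}$ denotes the density of $P^N$ given above. Let $\mu_\infty$ be the uniform law on the closed unit disc, with density $\varphi_\infty(z)=\pi^{-1}\mathbf 1_{|z|\le1}$. Then, for every fixed $k\ge1$,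 as $N\to\infty$, $P^{k,N}\to\mu_\infty^{\otimes k}$ weakly, i.e. $\int f\,dP^{k,N}\to\int f\,d\mu_\infty^{\otimes k}$ for every bounded continuous $f:\mathbb C^k\to\mathbb R$. Moreover, as $N\to\infty$, $$\varphi^{1,N}(z)\to\varphi_\infty(z)\quad\text{uniformly on every compact subset of }\{z\in\mathbb C:|z|\ne1\},$$ $$\varphi^{2,N}(z_1,z_2)\to\varphi_\infty(z_1)\varphi_\infty(z_2)\quad\text{uniformly on every compact subset of }\{(z_1,z_2)\in\mathbb C^2:|z_1|\ne1,\ |z_2|\ne1,\ z_1\ne z_2\}.$$ -/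

import Mathlib

open MeasureTheory

noncomputable section

namespace CoulombGas

/-- Configurations of `N` pairwise distinct particles in the plane `ℂ = ℝ²`. -/
def configSpace (N : ℕ) : Set (Fin N → ℂ) := {x | ∀ i j, i ≠ j → x i ≠ x j}

/-- The quadratic confinement potential. -/
def confinement (z : ℂ) : ℝ := ‖z‖ ^ 2

/-- The Coulomb pair repulsion (evaluated only at `z ≠ 0`). -/
def interaction (z : ℂ) : ℝ := Real.log (1 / ‖z‖ ^ 2)

/-- The energy `H` of a configuration of `N` particles; the double sum runs over ordered pairs
of distinct indices. -/
def energy (N : ℕ) (x : Fin N → ℂ) : ℝ :=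
  1 / (N : ℝ) * ∑ i, confinement (x i) +
    1 / (2 * (N : ℝ) ^ 2) *
      ∑ i, ∑ j ∈ Finset.univ.filter (fun j => i ≠ j), interaction (x i - x j)

/-- The partition function at inverse temperature `β`. -/
def partitionFunction (N : ℕ) (β : ℝ) : ℝ :=
  ∫ x in configSpace N, Real.exp (-β * energy N x)

/-- The density of the Boltzmann-Gibbs measure with respect to Lebesgue measure on `ℂ ^ N`,
extended by zero outside the configuration space. -/
def gibbsDensity (N : ℕ) (β : ℝ) : (Fin N → ℂ) → ℝ :=
  (configSpace N).indicator fun x => Real.exp (-β * energy N x) / partitionFunction N β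

/-- The Boltzmann-Gibbs measure at inverse temperature `β`, as a measure on `ℂ ^ N`. -/
def gibbs (N : ℕ) (β : ℝ) : Measure (Fin N → ℂ) :=
  volume.withDensity fun x => ENNReal.ofReal (gibbsDensity N β x)

/-- The marginal law of the first `k` particles, for `k ≤ N` (conventionally `0` if `N < k`). -/
def marginal (k N : ℕ) (β : ℝ) : Measure (Fin k → ℂ) :=
  if h : k ≤ N then (gibbs N β).map (fun x i => x (Fin.castLE h i)) else 0

/-- The density of the marginal law of the first `k` particles, for `k ≤ N`: the last `N - k`
variables of the Gibbs density are integrated out (conventionally `0` if `N < k`). -/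
def marginalDensity (k N : ℕ) (β : ℝ) (z : Fin k → ℂ) : ℝ :=
  if h : k ≤ N then
    ∫ w : Fin (N - k) → ℂ,
      gibbsDensity N β fun i => Fin.append z w (Fin.cast (Nat.add_sub_cancel' h).symm i)
  else 0

/-- The density of the uniform law on the closed unit disc. -/
def discDensity : ℂ → ℝ := (Metric.closedBall (0 : ℂ) 1).indicator fun _ => Real.pi⁻¹

/-- The uniform law on the closed unit disc. -/
def discLaw : Measure ℂ := volume.withDensity fun z => ENNReal.ofReal (discDensity z)

end CoulombGas

end

/-!
At inverse temperature `N ^ 2` the Boltzmann weight is `e^{-N ∑ |x_i|²} ∏_{i<j} |x_i - x_j|²`, a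
Gaussian weight times the square modulus of a Vandermonde determinant. Hence it is proportional to
`det (K_N(x_i, x_j))`, where `K_N` is the kernel of the orthogonal projection onto the span of the
first `N` normalized monomials of `L²(e^{-N|z|²})` (`exists_correlation_eq`). For a reproducing
kernel of rank `N`, integrating one variable out of the determinant of order `n + 1` gives
`N - n` times the determinant of order `n` (`integral_det_kernelMatrix_snoc`); this rests on the
expansion of a bordered determinant through the adjugate (`det_fromBlocks_adjugate`). Iterating,
the density of the first `k` particles is `(N - k)! / N! * det (K_N(z_i, z_j))`
(`marginalDensity_eq`); integrating out all variables gives the total mass `N!` and with it the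
partition function.

Everything else is the behaviour of `K_N / N`, which is up to a factor `π` a truncated exponential
series: `π K_N(z, w) / N = e^{-N(|z|² + |w|²)/2} ∑_{l < N} (N z w̄)^l / l!`. For `|z w̄| ≤ 1` the
missing tail of the series, and for `|z w̄| ≥ 1` the partial sum itself, is at most `|z w̄|^N e^N`.
With `s(z) = |z| e^{(1 - |z|²)/2}`, which is less than `1` off the unit circle, this gives
`|K_N(z, z) / N - φ_∞(z)| ≤ s(z)^{2N}` (`norm_scaledKernel_self_sub_le`) and
`|K_N(z, w) / N| ≤ e^{-N|z - w|²/2} + (s(z) s(w))^N` (`norm_scaledKernel_le`). On a compact set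
avoiding the circle and the diagonal all these rates are bounded by some `q < 1`, whence the two
uniform statements. For general `k` the matrix `K_N(z_i, z_j) / N` tends almost everywhere to the
diagonal matrix of the `φ_∞(z_i)`, so the marginal densities converge almost everywhere to the
product density (`tendsto_marginalDensity`), and Scheffé's lemma
(`tendsto_integral_mul_of_ae_tendsto`) turns this into weak convergence.
-/

open MeasureTheory

noncomputable section

namespace CoulombGas

/-! ### Bordered determinants and integration of a reproducing kernel -/

open Matrix Polynomial in
/-- Division-free Schur complement formula for a bordered determinant. The identity is first
obtained up to the factor `(det A) ^ n`; replacing `A` by the generic matrix `A + X` makes that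
factor a non-zero-divisor. -/
theorem det_fromBlocks_adjugate {n R : Type*} [Fintype n] [DecidableEq n] [CommRing R]
    (A : Matrix n n R) (u : Matrix n (Fin 1) R) (v : Matrix (Fin 1) n R)
    (D : Matrix (Fin 1) (Fin 1) R) :
    (fromBlocks A u v D).det = (A.det • D - v * A.adjugate * u).det := by
  have key : ∀ {S : Type _} [CommRing S] (A : Matrix n n S) (u : Matrix n (Fin 1) S)
      (v : Matrix (Fin 1) n S) (D : Matrix (Fin 1) (Fin 1) S),
      A.det ^ Fintype.card n * (fromBlocks A u v D).det =
        A.det ^ Fintype.card n * (A.det • D - v * A.adjugate * u).det := by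
    intro S _ A u v D
    have h : fromBlocks A u v D *
        fromBlocks A.adjugate (-(A.adjugate * u)) 0 (A.det • (1 : Matrix (Fin 1) (Fin 1) S)) =
        fromBlocks (A.det • (1 : Matrix n n S)) 0 (v * A.adjugate)
          (A.det • D - v * A.adjugate * u) := by
      rw [fromBlocks_multiply]
      congr 1
      · simp [mul_adjugate]
      · simp [Matrix.mul_neg, ← Matrix.mul_assoc, mul_adjugate]
      · simp
      · rw [Matrix.mul_neg, ← Matrix.mul_assoc, Matrix.mul_smul, Matrix.mul_one]
        abel
    have h2 := congrArg Matrix.det h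
    rw [det_mul, det_fromBlocks_zero₂₁, det_fromBlocks_zero₁₂, det_smul, det_one, det_smul,
      det_one] at h2
    have h3 : A.det * A.adjugate.det = A.det ^ Fintype.card n := by
      rw [← det_mul, mul_adjugate, det_smul, det_one, mul_one]
    simp only [Fintype.card_fin, pow_one, mul_one] at h2
    rw [← h2, ← h3]
    ring
  have hr : IsRegular (A.map C + (X : R[X]) • (1 : Matrix n n R[X])).det := by
    refine Polynomial.Monic.isRegular ?_
    simp only [Polynomial.Monic.def, ← Polynomial.leadingCoeff_det_X_one_add_C A, add_comm]
  have h := (hr.pow (Fintype.card n)).left (key (A.map C + (X : R[X]) • (1 : Matrix n n R[X]))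
    (u.map C) (v.map C) (D.map C))
  have h2 := congrArg (Polynomial.evalRingHom (0 : R)) h
  have hA : (A.map C + (X : R[X]) • (1 : Matrix n n R[X])).map (Polynomial.evalRingHom (0 : R))
      = A := by
    ext
    simp
  have hA' : (Polynomial.evalRingHom (0 : R)) (A.map C + (X : R[X]) • (1 : Matrix n n R[X])).det
      = A.det := by
    rw [RingHom.map_det, RingHom.mapMatrix_apply, hA]
  have hadj : (A.map C + (X : R[X]) • (1 : Matrix n n R[X])).adjugate.map
      (Polynomial.evalRingHom (0 : R)) = A.adjugate := by
    rw [← RingHom.mapMatrix_apply, RingHom.map_adjugate, RingHom.mapMatrix_apply, hA]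
  have hu : (u.map C).map (Polynomial.evalRingHom (0 : R)) = u := by ext; simp
  have hv : (v.map C).map (Polynomial.evalRingHom (0 : R)) = v := by ext; simp
  have hD : (D.map C).map (Polynomial.evalRingHom (0 : R)) = D := by ext; simp
  have hsD : ((A.map C + (X : R[X]) • (1 : Matrix n n R[X])).det • D.map C).map
      (Polynomial.evalRingHom (0 : R)) = A.det • D := by
    ext i j
    rw [Matrix.map_apply, Matrix.smul_apply, smul_eq_mul, map_mul, hA']
    simp
  rw [RingHom.map_det, RingHom.map_det, map_sub] at h2
  simp only [RingHom.mapMatrix_apply] at h2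
  rw [hsD, Matrix.map_mul, Matrix.map_mul, hadj, Matrix.fromBlocks_map, hA, hu, hv, hD] at h2
  exact h2

/-- The correlation matrix `(K(z_i, z_j))_{i,j}` of a kernel `K`. -/
def kernelMatrix {X : Type*} (K : X → X → ℂ) {n : ℕ} (z : Fin n → X) : Matrix (Fin n) (Fin n) ℂ :=
  Matrix.of fun i j => K (z i) (z j)

/-- Adjoining a point `t` borders the correlation matrix; the double sum is the Schur complement
term, arranged so that the reproducing property can be applied entrywise. -/
theorem det_kernelMatrix_snoc {X : Type*} (K : X → X → ℂ) {n : ℕ} (z : Fin n → X) (t : X) :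
    (kernelMatrix K (Fin.snoc z t : Fin (n + 1) → X)).det =
      K t t * (kernelMatrix K z).det -
        ∑ j, ∑ i, (kernelMatrix K z).adjugate i j * (K (z j) t * K t (z i)) := by
  have h := det_fromBlocks_adjugate (kernelMatrix K z) (Matrix.of fun i _ => K (z i) t)
    (Matrix.of fun _ i => K t (z i)) (Matrix.of fun _ _ => K t t)
  rw [← Matrix.det_submatrix_equiv_self (finSumFinEquiv (m := n) (n := 1))]
  have e : ∀ i : Fin 1, (Fin.snoc z t : Fin (n + 1) → X) (Fin.natAdd n i) = t := by
    intro i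
    obtain rfl : i = 0 := Subsingleton.elim _ _
    exact Fin.snoc_last (α := fun _ => X) _ _
  have e' : ∀ i : Fin n, (Fin.snoc z t : Fin (n + 1) → X) (Fin.castAdd 1 i) = z i :=
    fun i => Fin.snoc_castSucc (α := fun _ => X) _ _ i
  convert h using 2
  · ext i j
    rcases i with i | i <;> rcases j with j | j <;> simp [kernelMatrix, e, e']
  · rw [Matrix.det_fin_one, Matrix.sub_apply, Matrix.mul_apply]
    congr 1
    · simp [mul_comm]
    refine Finset.sum_congr rfl fun j _ => ?_
    rw [Matrix.mul_apply, Finset.sum_mul]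
    refine Finset.sum_congr rfl fun i _ => ?_
    simp only [Matrix.of_apply]
    ring

/-- Integrating out one variable of the `(n+1)`-point determinant of a reproducing kernel of
rank `N` produces `N - n` times the `n`-point determinant. -/
theorem integral_det_kernelMatrix_snoc {X : Type*} [MeasurableSpace X] {μ : Measure X}
    {K : X → X → ℂ} {N : ℕ}
    (hint : ∀ x y, Integrable (fun t => K x t * K t y) μ)
    (hrep : ∀ x y, ∫ t, K x t * K t y ∂μ = K x y)
    (hdint : Integrable (fun t => K t t) μ) (hdiag : ∫ t, K t t ∂μ = N)
    {n : ℕ} (z : Fin n → X) :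
    Integrable (fun t => (kernelMatrix K (Fin.snoc z t : Fin (n + 1) → X)).det) μ ∧
    ∫ t, (kernelMatrix K (Fin.snoc z t : Fin (n + 1) → X)).det ∂μ =
      ((N : ℂ) - n) * (kernelMatrix K z).det := by
  simp_rw [det_kernelMatrix_snoc]
  have h1 : Integrable (fun t => K t t * (kernelMatrix K z).det) μ := hdint.mul_const _
  have h2 : ∀ i j, Integrable
      (fun t => (kernelMatrix K z).adjugate i j * (K (z j) t * K t (z i))) μ :=
    fun i j => (hint _ _).const_mul _
  have h3 : ∀ j, Integrable
      (fun t => ∑ i, (kernelMatrix K z).adjugate i j * (K (z j) t * K t (z i))) μ :=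
    fun j => integrable_finsetSum _ fun i _ => h2 i j
  have h4 := integrable_finsetSum Finset.univ fun j _ => h3 j
  refine ⟨h1.sub h4, ?_⟩
  rw [integral_sub h1 h4, integral_mul_const, hdiag, integral_finsetSum _ fun j _ => h3 j]
  have h5 : ∀ j, ∫ t, ∑ i, (kernelMatrix K z).adjugate i j * (K (z j) t * K t (z i)) ∂μ =
      (kernelMatrix K z).det := by
    intro j
    rw [integral_finsetSum _ fun i _ => h2 i j]
    simp_rw [integral_const_mul, hrep]
    -- what remains is a diagonal entry of `A * adjugate A = det A • 1`
    have := congrFun (congrFun (Matrix.mul_adjugate (kernelMatrix K z)) j) j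
    rw [Matrix.mul_apply] at this
    simp only [Matrix.smul_apply, Matrix.one_apply_eq, smul_eq_mul, mul_one] at this
    rw [← this]
    exact Finset.sum_congr rfl fun i _ => mul_comm _ _
  simp_rw [h5]
  simp
  ring

/-! ### The Ginibre kernel -/

/-- The `l`-th normalized monomial of the Gaussian weight `e^{-N|z|²}`, with the square root of the
weight included; these functions are orthonormal in `L²(ℂ)`. -/
def orbital (N l : ℕ) (z : ℂ) : ℂ :=
  (√((N : ℝ) ^ (l + 1) / (Real.pi * l.factorial)) * Real.exp (-(N : ℝ) * ‖z‖ ^ 2 / 2) : ℝ) * z ^ l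

/-- The Ginibre kernel: the orthogonal projection of `L²(ℂ)` onto the span of the first `N`
orbitals. -/
def ginibreKernel (N : ℕ) (z w : ℂ) : ℂ :=
  ∑ l : Fin N, orbital N l z * star (orbital N l w)

@[fun_prop]
theorem continuous_orbital (N l : ℕ) : Continuous (orbital N l) := by
  unfold orbital
  fun_prop

theorem integral_norm_pow_mul_gaussian {N : ℕ} (hN : 0 < N) (n : ℕ) :
    ∫ z : ℂ, ‖z‖ ^ n * Real.exp (-(N : ℝ) * ‖z‖ ^ 2) =
      Real.pi * (N : ℝ) ^ (-((n : ℝ) + 2) / 2) * Real.Gamma (((n : ℝ) + 2) / 2) := by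
  have h := Complex.integral_rpow_mul_exp_neg_mul_rpow (p := 2) (q := n) (b := N) (by norm_num)
    (by linarith [n.cast_nonneg (α := ℝ)]) (by exact_mod_cast hN)
  simpa [-neg_add_rev] using h

/-- Integrability is read off from the explicit nonzero value of the integral. -/
theorem integrable_norm_pow_mul_gaussian {N : ℕ} (hN : 0 < N) (n : ℕ) :
    Integrable fun z : ℂ => ‖z‖ ^ n * Real.exp (-(N : ℝ) * ‖z‖ ^ 2) := by
  refine Integrable.of_integral_ne_zero ?_
  rw [integral_norm_pow_mul_gaussian hN]
  have : (0 : ℝ) < N := by exact_mod_cast hN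
  have := Real.Gamma_pos_of_pos (s := ((n : ℝ) + 2) / 2) (by positivity)
  positivity

theorem orbital_mul_star (N l m : ℕ) (z : ℂ) :
    orbital N l z * star (orbital N m z) =
      (√((N : ℝ) ^ (l + 1) / (Real.pi * l.factorial)) *
        √((N : ℝ) ^ (m + 1) / (Real.pi * m.factorial)) : ℝ) *
      ((Real.exp (-(N : ℝ) * ‖z‖ ^ 2) : ℝ) * (z ^ l * star z ^ m)) := by
  have : Real.exp (-(N : ℝ) * ‖z‖ ^ 2) =
      Real.exp (-(N : ℝ) * ‖z‖ ^ 2 / 2) * Real.exp (-(N : ℝ) * ‖z‖ ^ 2 / 2) := by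
    rw [← Real.exp_add]
    ring_nf
  rw [this]
  simp only [orbital, star_mul', star_pow, Complex.star_def, Complex.conj_ofReal]
  push_cast
  ring

theorem integrable_orbital_mul_star {N : ℕ} (hN : 0 < N) (l m : ℕ) :
    Integrable fun z => orbital N l z * star (orbital N m z) := by
  simp_rw [orbital_mul_star]
  refine Integrable.const_mul ?_ _
  refine (integrable_norm_pow_mul_gaussian hN (l + m)).mono' (by fun_prop) (.of_forall fun z => ?_)
  simp only [norm_mul, Complex.norm_real, norm_pow, norm_star, Real.norm_eq_abs, Real.abs_exp]
  rw [pow_add]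
  exact (mul_comm _ _).le

/-- Distinct monomials are orthogonal because the weight is rotation invariant. -/
theorem integral_monomial_mul_star_eq_zero (N : ℕ) {l m : ℕ} (hlm : l ≠ m) :
    ∫ z : ℂ, ((Real.exp (-(N : ℝ) * ‖z‖ ^ 2) : ℝ) : ℂ) * (z ^ l * star z ^ m) = 0 := by
  have hd : ((l : ℂ) - m) ≠ 0 := sub_ne_zero.mpr (by exact_mod_cast hlm)
  -- the rotation is chosen so that it multiplies `z ^ l * star z ^ m` by `-1`
  have h := (rotation (Circle.exp (Real.pi / ((l : ℝ) - m)))).measurePreserving.integral_comp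
    (rotation (Circle.exp (Real.pi / ((l : ℝ) - m)))).toHomeomorph.measurableEmbedding
    (fun z : ℂ => ((Real.exp (-(N : ℝ) * ‖z‖ ^ 2) : ℝ) : ℂ) * (z ^ l * star z ^ m))
  have e : ((Circle.exp (Real.pi / ((l : ℝ) - m)) : Circle) : ℂ) ^ l *
      star ((Circle.exp (Real.pi / ((l : ℝ) - m)) : Circle) : ℂ) ^ m = -1 := by
    rw [Circle.coe_exp, Complex.star_def, ← Complex.exp_conj, ← Complex.exp_nat_mul,
      ← Complex.exp_nat_mul, ← Complex.exp_add, ← Complex.exp_pi_mul_I]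
    congr 1
    simp only [map_mul, Complex.conj_ofReal, Complex.conj_I]
    push_cast
    field_simp
    ring
  simp only [rotation_apply, norm_mul, Circle.norm_coe, one_mul, mul_pow, star_mul'] at h
  have h2 : ∀ z : ℂ, ((Real.exp (-(N : ℝ) * ‖z‖ ^ 2) : ℝ) : ℂ) *
      (((Circle.exp (Real.pi / ((l : ℝ) - m)) : Circle) : ℂ) ^ l * z ^ l *
      (star ((Circle.exp (Real.pi / ((l : ℝ) - m)) : Circle) : ℂ) ^ m * star z ^ m)) =
      -(((Real.exp (-(N : ℝ) * ‖z‖ ^ 2) : ℝ) : ℂ) * (z ^ l * star z ^ m)) := by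
    intro z
    linear_combination ((Real.exp (-(N : ℝ) * ‖z‖ ^ 2) : ℝ) : ℂ) * (z ^ l * star z ^ m) * e
  simp_rw [h2, integral_neg] at h
  exact self_eq_neg.mp h.symm

theorem integral_orbital_mul_star {N : ℕ} (hN : 0 < N) (l m : ℕ) :
    ∫ z, orbital N l z * star (orbital N m z) = if l = m then 1 else 0 := by
  simp_rw [orbital_mul_star]
  rw [integral_const_mul]
  split_ifs with h
  · subst h
    have h1 : ∀ z : ℂ, ((Real.exp (-(N : ℝ) * ‖z‖ ^ 2) : ℝ) : ℂ) * (z ^ l * star z ^ l) =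
        ((‖z‖ ^ (2 * l) * Real.exp (-(N : ℝ) * ‖z‖ ^ 2) : ℝ) : ℂ) := by
      intro z
      rw [← mul_pow, Complex.star_def, Complex.mul_conj, Complex.normSq_eq_norm_sq]
      push_cast
      ring
    simp_rw [h1]
    rw [integral_complex_ofReal, integral_norm_pow_mul_gaussian hN, ← Complex.ofReal_mul,
      Real.mul_self_sqrt (by positivity)]
    have hN' : (0 : ℝ) < N := by exact_mod_cast hN
    have e1 : (((2 * l : ℕ) : ℝ) + 2) / 2 = l + 1 := by push_cast; ring
    have e2 : -(((2 * l : ℕ) : ℝ) + 2) / 2 = -((l + 1 : ℕ) : ℝ) := by push_cast; ring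
    rw [e1, e2, Real.Gamma_nat_eq_factorial, Real.rpow_neg hN'.le, Real.rpow_natCast]
    have := Real.pi_pos
    have : (0 : ℝ) < l.factorial := by positivity
    norm_cast
    field_simp
  · rw [integral_monomial_mul_star_eq_zero N h, mul_zero]

@[fun_prop]
theorem continuous_ginibreKernel (N : ℕ) {α : Type*} [TopologicalSpace α] {f g : α → ℂ}
    (hf : Continuous f) (hg : Continuous g) : Continuous fun a => ginibreKernel N (f a) (g a) := by
  unfold ginibreKernel
  fun_prop

theorem ginibreKernel_mul_ginibreKernel (N : ℕ) (x y t : ℂ) :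
    ginibreKernel N x t * ginibreKernel N t y = ∑ l : Fin N, ∑ m : Fin N,
      (orbital N l x * star (orbital N m y)) * (orbital N m t * star (orbital N l t)) := by
  unfold ginibreKernel
  rw [Finset.sum_mul_sum]
  refine Finset.sum_congr rfl fun l _ => Finset.sum_congr rfl fun m _ => ?_
  ring

theorem integrable_ginibreKernel_mul {N : ℕ} (hN : 0 < N) (x y : ℂ) :
    Integrable fun t => ginibreKernel N x t * ginibreKernel N t y := by
  simp_rw [ginibreKernel_mul_ginibreKernel]
  exact integrable_finsetSum _ fun l _ => integrable_finsetSum _ fun m _ =>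
    (integrable_orbital_mul_star hN _ _).const_mul _

theorem integral_ginibreKernel_mul {N : ℕ} (hN : 0 < N) (x y : ℂ) :
    ∫ t, ginibreKernel N x t * ginibreKernel N t y = ginibreKernel N x y := by
  simp_rw [ginibreKernel_mul_ginibreKernel]
  rw [integral_finsetSum _ fun l _ => integrable_finsetSum _ fun m _ =>
    (integrable_orbital_mul_star hN _ _).const_mul _]
  unfold ginibreKernel
  refine Finset.sum_congr rfl fun l _ => ?_
  rw [integral_finsetSum _ fun m _ => (integrable_orbital_mul_star hN _ _).const_mul _]
  simp_rw [integral_const_mul, integral_orbital_mul_star hN]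
  simp [Fin.val_inj]

theorem integrable_ginibreKernel_self {N : ℕ} (hN : 0 < N) :
    Integrable fun t => ginibreKernel N t t :=
  integrable_finsetSum _ fun _ _ => integrable_orbital_mul_star hN _ _

theorem integral_ginibreKernel_self {N : ℕ} (hN : 0 < N) :
    ∫ t, ginibreKernel N t t = N := by
  unfold ginibreKernel
  rw [integral_finsetSum _ fun l _ => integrable_orbital_mul_star hN _ _]
  simp_rw [integral_orbital_mul_star hN]
  simp

/-- The `n`-point correlation function `det (K_N(z_i, z_j))` of the Ginibre ensemble of size `N`;
the determinant is real and nonnegative, the matrix being a Gram matrix. -/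
def correlation (N n : ℕ) (z : Fin n → ℂ) : ℝ := (kernelMatrix (ginibreKernel N) z).det.re

theorem kernelMatrix_ginibreKernel (N : ℕ) {n : ℕ} (z : Fin n → ℂ) :
    kernelMatrix (ginibreKernel N) z =
      (Matrix.of fun (i : Fin n) (l : Fin N) => orbital N l (z i)) *
        (Matrix.of fun (i : Fin n) (l : Fin N) => orbital N l (z i)).conjTranspose := by
  ext i j
  simp [kernelMatrix, ginibreKernel, Matrix.mul_apply]

open ComplexOrder in
theorem det_kernelMatrix_ginibreKernel_nonneg (N : ℕ) {n : ℕ} (z : Fin n → ℂ) :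
    0 ≤ (kernelMatrix (ginibreKernel N) z).det := by
  rw [kernelMatrix_ginibreKernel]
  exact (Matrix.posSemidef_self_mul_conjTranspose _).det_nonneg

theorem correlation_nonneg (N : ℕ) {n : ℕ} (z : Fin n → ℂ) : 0 ≤ correlation N n z :=
  (Complex.nonneg_iff.mp (det_kernelMatrix_ginibreKernel_nonneg N z)).1

theorem ofReal_correlation (N : ℕ) {n : ℕ} (z : Fin n → ℂ) :
    (correlation N n z : ℂ) = (kernelMatrix (ginibreKernel N) z).det :=
  Complex.ext rfl (Complex.nonneg_iff.mp (det_kernelMatrix_ginibreKernel_nonneg N z)).2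

@[fun_prop]
theorem continuous_correlation (N n : ℕ) : Continuous (correlation N n) := by
  unfold correlation
  refine Complex.continuous_re.comp (Continuous.matrix_det ?_)
  refine continuous_matrix fun i j => ?_
  simp only [kernelMatrix, Matrix.of_apply]
  fun_prop

theorem integrable_correlation_snoc {N : ℕ} (hN : 0 < N) {n : ℕ} (z : Fin n → ℂ) :
    Integrable fun t : ℂ => correlation N (n + 1) (Fin.snoc z t) :=
  (integral_det_kernelMatrix_snoc (integrable_ginibreKernel_mul hN)
    (integral_ginibreKernel_mul hN) (integrable_ginibreKernel_self hN)
    (integral_ginibreKernel_self hN) z).1.re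

theorem integral_correlation_snoc {N : ℕ} (hN : 0 < N) {n : ℕ} (z : Fin n → ℂ) :
    ∫ t : ℂ, correlation N (n + 1) (Fin.snoc z t) = ((N : ℝ) - n) * correlation N n z := by
  have h := (integral_det_kernelMatrix_snoc (integrable_ginibreKernel_mul hN)
    (integral_ginibreKernel_mul hN) (integrable_ginibreKernel_self hN)
    (integral_ginibreKernel_self hN) z).2
  simp_rw [← ofReal_correlation] at h
  rw [integral_complex_ofReal] at h
  exact_mod_cast h

/-! ### Fubini for correlation functions and the Boltzmann weight -/

theorem measurePreserving_append (n m : ℕ) :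
    MeasurePreserving (fun p : (Fin n → ℂ) × (Fin m → ℂ) => Fin.append p.1 p.2) := by
  have h := (volume_measurePreserving_piCongrLeft (fun _ : Fin (n + m) => ℂ)
    finSumFinEquiv).comp
    (volume_measurePreserving_sumPiEquivProdPi_symm (fun _ : Fin n ⊕ Fin m => ℂ))
  have e : (fun p : (Fin n → ℂ) × (Fin m → ℂ) => Fin.append p.1 p.2) =
      MeasurableEquiv.piCongrLeft (fun _ : Fin (n + m) => ℂ) finSumFinEquiv ∘
        (MeasurableEquiv.sumPiEquivProdPi (fun _ : Fin n ⊕ Fin m => ℂ)).symm := by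
    funext p i
    obtain ⟨j, rfl⟩ := finSumFinEquiv.surjective i
    simp only [Function.comp_apply, MeasurableEquiv.coe_piCongrLeft, Equiv.piCongrLeft_apply_apply]
    rcases j with j | j <;> simp [MeasurableEquiv.coe_sumPiEquivProdPi_symm]
  rw [e]
  exact h

theorem measurePreserving_snoc (n : ℕ) :
    MeasurePreserving (fun p : (Fin n → ℂ) × ℂ => (Fin.snoc p.1 p.2 : Fin (n + 1) → ℂ)) := by
  have h := (volume_preserving_piFinSuccAbove (fun _ : Fin (n + 1) => ℂ) (Fin.last n)).symm.comp
    (Measure.measurePreserving_swap (μ := (volume : Measure (Fin n → ℂ))) (ν := (volume : Measure ℂ)))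
  have e : (fun p : (Fin n → ℂ) × ℂ => (Fin.snoc p.1 p.2 : Fin (n + 1) → ℂ)) =
      (MeasurableEquiv.piFinSuccAbove (fun _ => ℂ) (Fin.last n)).symm ∘ Prod.swap := by
    funext p
    exact (Fin.insertNth_last' _ _).symm
  rw [e]
  exact h

theorem lintegral_append {n m : ℕ} {f : (Fin (n + m) → ℂ) → ENNReal} (hf : Measurable f) :
    ∫⁻ x, f x = ∫⁻ z : Fin n → ℂ, ∫⁻ w : Fin m → ℂ, f (Fin.append z w) := by
  rw [← (measurePreserving_append n m).lintegral_comp hf, Measure.volume_eq_prod,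
    lintegral_prod]
  exact (hf.comp (measurePreserving_append n m).measurable).aemeasurable

theorem lintegral_snoc {n : ℕ} {f : (Fin (n + 1) → ℂ) → ENNReal} (hf : Measurable f) :
    ∫⁻ x, f x = ∫⁻ z : Fin n → ℂ, ∫⁻ t : ℂ, f (Fin.snoc z t) := by
  rw [← (measurePreserving_snoc n).lintegral_comp hf, Measure.volume_eq_prod,
    lintegral_prod]
  exact (hf.comp (measurePreserving_snoc n).measurable).aemeasurable

/-- Integrating `m` variables out of the correlation function of order `n + m`. -/
theorem lintegral_correlation_append {N : ℕ} (hN : 0 < N) {n : ℕ} (z : Fin n → ℂ) (m : ℕ)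
    (h : n + m ≤ N) :
    ∫⁻ w : Fin m → ℂ, ENNReal.ofReal (correlation N (n + m) (Fin.append z w)) =
      ENNReal.ofReal ((N - n).descFactorial m * correlation N n z) := by
  induction m with
  | zero =>
    rw [Measure.volume_pi_eq_dirac (fun i => i.elim0), lintegral_dirac]
    simp [Fin.append_right_nil]
  | succ m ih =>
    have hmeas : Measurable fun w : Fin (m + 1) → ℂ =>
        ENNReal.ofReal (correlation N (n + (m + 1)) (Fin.append z w)) := by fun_prop
    rw [lintegral_snoc hmeas]
    have h1 : ∀ w : Fin m → ℂ,
        ∫⁻ t : ℂ, ENNReal.ofReal (correlation N (n + (m + 1)) (Fin.append z (Fin.snoc w t))) =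
        ENNReal.ofReal ((N - n - m : ℕ) : ℝ) *
          ENNReal.ofReal (correlation N (n + m) (Fin.append z w)) := by
      intro w
      have e : ∀ t : ℂ, Fin.append z (Fin.snoc w t : Fin (m + 1) → ℂ) =
          (Fin.snoc (Fin.append z w) t : Fin (n + m + 1) → ℂ) := fun t => Fin.append_snoc z w t
      simp_rw [e]
      rw [← ENNReal.ofReal_mul (by positivity)]
      have h2 := integral_correlation_snoc hN (Fin.append z w)
      have h3 : ((N - n - m : ℕ) : ℝ) = (N : ℝ) - ((n + m : ℕ) : ℝ) := by
        rw [Nat.sub_sub, Nat.cast_sub (by omega)]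
      rw [h3, ← h2]
      exact (ofReal_integral_eq_lintegral_ofReal (integrable_correlation_snoc hN _)
        (.of_forall fun t => correlation_nonneg N _)).symm
    simp_rw [h1]
    rw [lintegral_const_mul _ (by fun_prop), ih (by omega), ← ENNReal.ofReal_mul (by positivity),
      Nat.descFactorial_succ]
    push_cast
    ring_nf

theorem correlation_comp_cast (N : ℕ) {n n' : ℕ} (h : n' = n) (z : Fin n → ℂ) :
    correlation N n' (z ∘ Fin.cast h) = correlation N n z := by
  subst h
  rfl

theorem lintegral_correlation {N n : ℕ} (hN : 0 < N) (h : n ≤ N) :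
    ∫⁻ z : Fin n → ℂ, ENNReal.ofReal (correlation N n z) =
      ENNReal.ofReal (N.descFactorial n) := by
  have h1 := lintegral_correlation_append hN (![] : Fin 0 → ℂ) n (by omega)
  have h0 : correlation N 0 (![] : Fin 0 → ℂ) = 1 := by simp [correlation]
  rw [h0, mul_one, Nat.sub_zero] at h1
  simp_rw [Fin.append_left_nil _ _ rfl, correlation_comp_cast] at h1
  exact h1

/-- The square modulus of the Slater determinant of the orbitals is the Boltzmann weight. -/
theorem exists_correlation_eq {N : ℕ} (hN : 0 < N) : ∃ C : ℝ, 0 < C ∧ ∀ x : Fin N → ℂ,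
    correlation N N x =
      (configSpace N).indicator (fun x => C * Real.exp (-(N : ℝ) ^ 2 * energy N x)) x := by
  have hN' : (0 : ℝ) < N := by exact_mod_cast hN
  have hdet : ∀ x : Fin N → ℂ, correlation N N x =
      (∏ l : Fin N, √((N : ℝ) ^ ((l : ℕ) + 1) / (Real.pi * (l : ℕ).factorial))) ^ 2 *
        (Real.exp (-(N : ℝ) * ∑ i, ‖x i‖ ^ 2) * ‖(Matrix.vandermonde x).det‖ ^ 2) := by
    intro x
    have hB : (Matrix.of fun (i : Fin N) (l : Fin N) => orbital N l (x i)) =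
        Matrix.diagonal (fun i => ((Real.exp (-(N : ℝ) * ‖x i‖ ^ 2 / 2) : ℝ) : ℂ)) *
          Matrix.vandermonde x * Matrix.diagonal (fun l : Fin N =>
          ((√((N : ℝ) ^ ((l : ℕ) + 1) / (Real.pi * (l : ℕ).factorial)) : ℝ) : ℂ)) := by
      ext i l
      rw [Matrix.mul_diagonal, Matrix.diagonal_mul]
      simp only [Matrix.of_apply, orbital, Matrix.vandermonde_apply]
      push_cast
      ring
    rw [correlation, kernelMatrix_ginibreKernel, Matrix.det_mul, Matrix.det_conjTranspose, hB,
      Complex.star_def, Complex.mul_conj, Complex.ofReal_re, Complex.normSq_eq_norm_sq,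
      Matrix.det_mul, Matrix.det_mul, Matrix.det_diagonal, Matrix.det_diagonal,
      ← Complex.ofReal_prod, ← Complex.ofReal_prod, norm_mul, norm_mul, Complex.norm_real,
      Complex.norm_real, Real.norm_eq_abs, Real.norm_eq_abs, mul_pow, mul_pow, sq_abs, sq_abs,
      ← Real.exp_sum, ← Real.exp_nat_mul]
    have : ((2 : ℕ) : ℝ) * ∑ i, -(N : ℝ) * ‖x i‖ ^ 2 / 2 = -(N : ℝ) * ∑ i, ‖x i‖ ^ 2 := by
      rw [Finset.mul_sum, Finset.mul_sum]
      refine Finset.sum_congr rfl fun i _ => ?_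
      push_cast
      ring
    rw [this]
    ring
  refine ⟨(∏ l : Fin N, √((N : ℝ) ^ ((l : ℕ) + 1) / (Real.pi * (l : ℕ).factorial))) ^ 2, ?_,
    fun x => ?_⟩
  rotate_left
  · rw [hdet x]
    by_cases hx : x ∈ configSpace N
    · rw [Set.indicator_of_mem hx]
      congr 1
      have hpos : ∀ i, ∀ j, i ≠ j → 0 < ‖x i - x j‖ := fun i j hij =>
        norm_pos_iff.mpr (sub_ne_zero.mpr (hx i j hij))
      have hV : ‖(Matrix.vandermonde x).det‖ ^ 2 =
          Real.exp (∑ i, ∑ j ∈ Finset.Ioi i, -interaction (x i - x j)) := by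
        rw [Matrix.det_vandermonde, norm_prod, ← Finset.prod_pow, Real.exp_sum]
        refine Finset.prod_congr rfl fun i _ => ?_
        rw [norm_prod, ← Finset.prod_pow, Real.exp_sum]
        refine Finset.prod_congr rfl fun j hj => ?_
        have := hpos i j (Finset.mem_Ioi.mp hj).ne
        rw [interaction, one_div, Real.log_inv, neg_neg, Real.exp_log (by positivity),
          norm_sub_rev]
      have hsymm : ∀ z : ℂ, interaction (-z) = interaction z := fun z => by
        rw [interaction, norm_neg, interaction]
      have hs2 : ∑ i, ∑ j ∈ Finset.univ.filter (fun j => i ≠ j), interaction (x i - x j) =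
          2 * ∑ i, ∑ j ∈ Finset.Ioi i, interaction (x i - x j) := by
        have hs := Finset.sum_sum_Ioi_add_eq_sum_sum_off_diag
          (fun i j : Fin N => interaction (x j - x i))
        have hc : ∀ i : Fin N, Finset.univ.filter (fun j => i ≠ j) = {i}ᶜ := fun i => by
          ext j
          simp [eq_comm]
        simp_rw [hc, ← hs, Finset.mul_sum]
        refine Finset.sum_congr rfl fun i _ => Finset.sum_congr rfl fun j _ => ?_
        rw [← hsymm (x j - x i), neg_sub]
        ring
      rw [hV, ← Real.exp_add, energy, hs2]
      congr 1
      simp only [confinement, Finset.sum_neg_distrib]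
      field_simp
      ring
    · rw [Set.indicator_of_notMem hx]
      have : (Matrix.vandermonde x).det = 0 := by
        rw [Matrix.det_vandermonde_eq_zero_iff]
        simp only [configSpace, Set.mem_ofPred_eq, not_forall, not_not] at hx
        obtain ⟨i, j, hij, h⟩ := hx
        exact ⟨i, j, h, hij⟩
      simp [this]
  · have := Real.pi_pos
    refine pow_pos (Finset.prod_pos fun l _ => Real.sqrt_pos.mpr ?_) 2
    positivity

/-! ### The Gibbs measure as a determinantal ensemble -/

theorem measurableSet_configSpace (N : ℕ) : MeasurableSet (configSpace N) := by
  have : configSpace N = ⋂ i, ⋂ j, ⋂ (_ : i ≠ j), {x : Fin N → ℂ | x i = x j}ᶜ := by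
    ext x
    simp [configSpace]
  rw [this]
  exact .iInter fun i => .iInter fun j => .iInter fun _ =>
    (measurableSet_eq_fun (measurable_pi_apply i) (measurable_pi_apply j)).compl

theorem integrable_correlation {N n : ℕ} (hN : 0 < N) (h : n ≤ N) :
    Integrable fun z : Fin n → ℂ => correlation N n z := by
  refine ⟨(continuous_correlation N n).aestronglyMeasurable, ?_⟩
  rw [hasFiniteIntegral_iff_ofReal (.of_forall fun z => correlation_nonneg N z),
    lintegral_correlation hN h]
  exact ENNReal.ofReal_lt_top

theorem integral_correlation {N n : ℕ} (hN : 0 < N) (h : n ≤ N) :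
    ∫ z : Fin n → ℂ, correlation N n z = N.descFactorial n := by
  rw [integral_eq_lintegral_of_nonneg_ae (.of_forall fun z => correlation_nonneg N z)
    (continuous_correlation N n).aestronglyMeasurable, lintegral_correlation hN h,
    ENNReal.toReal_ofReal (by positivity)]

/-- At inverse temperature `N ^ 2` the Gibbs measure is the determinantal Ginibre ensemble. -/
theorem gibbsDensity_eq {N : ℕ} (hN : 0 < N) (x : Fin N → ℂ) :
    gibbsDensity N ((N : ℝ) ^ 2) x = correlation N N x / N.factorial := by
  obtain ⟨C, hC, h⟩ := exists_correlation_eq hN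
  -- the constant `C` is absorbed by the partition function, because the correlation function of
  -- full order has total mass `N!`
  have hZ : C * partitionFunction N ((N : ℝ) ^ 2) = N.factorial := by
    have h1 := integral_correlation hN le_rfl
    rw [Nat.descFactorial_self] at h1
    simp_rw [h] at h1
    rw [integral_indicator (measurableSet_configSpace N), integral_const_mul] at h1
    exact h1
  rw [h, gibbsDensity, ← hZ]
  by_cases hx : x ∈ configSpace N
  · rw [Set.indicator_of_mem hx, Set.indicator_of_mem hx, mul_div_mul_left _ _ hC.ne']
  · rw [Set.indicator_of_notMem hx, Set.indicator_of_notMem hx, zero_div]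

theorem lintegral_gibbsDensity_append {N k m : ℕ} (hN : 0 < N) (h : N = k + m) (z : Fin k → ℂ) :
    ∫⁻ w : Fin m → ℂ, ENNReal.ofReal
        (gibbsDensity N ((N : ℝ) ^ 2) fun i => Fin.append z w (Fin.cast h i)) =
      ENNReal.ofReal (correlation N k z / N.descFactorial k) := by
  have h1 := lintegral_correlation_append hN z m h.ge
  have h2 : N - k = m := by omega
  have h3 : (N.factorial : ℝ) = N.descFactorial k * m.factorial := by
    rw [← Nat.factorial_mul_descFactorial (show k ≤ N by omega), h2]
    push_cast
    ring
  rw [h2, Nat.descFactorial_self] at h1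
  have h4 : ∀ w : Fin m → ℂ, ENNReal.ofReal
      (gibbsDensity N ((N : ℝ) ^ 2) fun i => Fin.append z w (Fin.cast h i)) =
      ENNReal.ofReal (N.factorial : ℝ)⁻¹ *
        ENNReal.ofReal (correlation N (k + m) (Fin.append z w)) := by
    intro w
    rw [gibbsDensity_eq hN, ← ENNReal.ofReal_mul (by positivity), mul_comm, ← div_eq_mul_inv,
      ← correlation_comp_cast N h]
    rfl
  simp_rw [h4]
  rw [lintegral_const_mul _ (by fun_prop), h1, ← ENNReal.ofReal_mul (by positivity), h3]
  congr 1
  have : (0 : ℝ) < m.factorial := by positivity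
  field_simp

theorem continuous_gibbsDensity {N : ℕ} (hN : 0 < N) :
    Continuous (gibbsDensity N ((N : ℝ) ^ 2)) := by
  rw [funext (gibbsDensity_eq hN)]
  fun_prop

/-- The density of the first `k` particles is `(N - k)! / N! * det (K_N(z_i, z_j))`. -/
theorem marginalDensity_eq {k N : ℕ} (hN : 0 < N) (h : k ≤ N) (z : Fin k → ℂ) :
    marginalDensity k N ((N : ℝ) ^ 2) z = correlation N k z / N.descFactorial k := by
  rw [marginalDensity, dif_pos h, integral_eq_lintegral_of_nonneg_ae,
    lintegral_gibbsDensity_append hN (Nat.add_sub_cancel' h).symm,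
    ENNReal.toReal_ofReal (div_nonneg (correlation_nonneg N z) (by positivity))]
  · refine .of_forall fun w => ?_
    simp only [gibbsDensity_eq hN, Pi.zero_apply]
    exact div_nonneg (correlation_nonneg N _) (by positivity)
  · refine Continuous.aestronglyMeasurable ((continuous_gibbsDensity hN).comp ?_)
    exact continuous_pi fun i => (continuous_apply _).comp
      ((Fin.continuous_append k (N - k)).comp (by fun_prop : Continuous fun w => (z, w)))

theorem marginal_eq_withDensity {k N : ℕ} (hN : 0 < N) (h : k ≤ N) :
    marginal k N ((N : ℝ) ^ 2) =
      volume.withDensity fun z => ENNReal.ofReal (marginalDensity k N ((N : ℝ) ^ 2) z) := by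
  rw [marginal, dif_pos h]
  simp_rw [marginalDensity_eq hN h]
  obtain ⟨m, hm⟩ := Nat.exists_eq_add_of_le h
  have hp : Measurable fun (x : Fin N → ℂ) (i : Fin k) => x (Fin.castLE h i) := by fun_prop
  have hg : Measurable fun x => ENNReal.ofReal (gibbsDensity N ((N : ℝ) ^ 2) x) :=
    (continuous_gibbsDensity hN).measurable.ennreal_ofReal
  ext S hS
  rw [Measure.map_apply hp hS, gibbs, withDensity_apply _ (hp hS), withDensity_apply _ hS,
    ← lintegral_indicator (hp hS), ← lintegral_indicator hS]
  simp_rw [← lintegral_gibbsDensity_append hN hm]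
  have key : ∀ (n : ℕ) (e : n = k + m) (f : (Fin n → ℂ) → ENNReal), Measurable f →
      ∫⁻ x, f x = ∫⁻ z : Fin k → ℂ, ∫⁻ w : Fin m → ℂ, f fun i => Fin.append z w (Fin.cast e i) := by
    rintro n rfl f hf
    exact lintegral_append hf
  rw [key N hm _ (hg.indicator (hp hS))]
  refine lintegral_congr fun z => ?_
  have e : ∀ w : Fin m → ℂ, (fun i : Fin k => Fin.append z w (Fin.cast hm (Fin.castLE h i))) = z :=
    fun w => funext fun i => Fin.append_left z w i
  by_cases hz : z ∈ S
  · rw [Set.indicator_of_mem hz]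
    refine lintegral_congr fun w => Set.indicator_of_mem ?_ _
    rw [Set.mem_preimage, e]
    exact hz
  · rw [Set.indicator_of_notMem hz, ← lintegral_zero (μ := (volume : Measure (Fin m → ℂ)))]
    refine lintegral_congr fun w => Set.indicator_of_notMem ?_ _
    rw [Set.mem_preimage, e]
    exact hz

theorem isProbabilityMeasure_gibbs {N : ℕ} (hN : 0 < N) :
    IsProbabilityMeasure (gibbs N ((N : ℝ) ^ 2)) := by
  refine ⟨?_⟩
  rw [gibbs, withDensity_apply _ .univ, Measure.restrict_univ]
  simp_rw [gibbsDensity_eq hN]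
  rw [← ofReal_integral_eq_lintegral_ofReal ((integrable_correlation hN le_rfl).div_const _)
    (.of_forall fun x => div_nonneg (correlation_nonneg N x) (by positivity)),
    integral_div, integral_correlation hN le_rfl, Nat.descFactorial_self, div_self (by positivity),
    ENNReal.ofReal_one]

/-! ### Asymptotics of the kernel -/

/-- The exponential rate `|z| e^{(1-|z|²)/2}` governing the tails of the truncated exponential
series; it is less than `1` off the unit circle. -/
def tailRate (z : ℂ) : ℝ := ‖z‖ * Real.exp ((1 - ‖z‖ ^ 2) / 2)

theorem tailRate_nonneg (z : ℂ) : 0 ≤ tailRate z := by unfold tailRate; positivity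

@[fun_prop]
theorem continuous_tailRate : Continuous tailRate := by unfold tailRate; fun_prop

theorem tailRate_lt_one {z : ℂ} (hz : ‖z‖ ≠ 1) : tailRate z < 1 := by
  have h : ‖z‖ ^ 2 - 1 ≠ 0 := fun h => hz <| by
    have := norm_nonneg z
    nlinarith
  have h1 := Real.add_one_lt_exp h
  have h2 : tailRate z ^ 2 = ‖z‖ ^ 2 * Real.exp (-(‖z‖ ^ 2 - 1)) := by
    rw [tailRate, mul_pow, ← Real.exp_nat_mul]
    congr 2
    push_cast
    ring
  have h3 : tailRate z ^ 2 < 1 := by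
    rw [h2, Real.exp_neg, ← div_eq_mul_inv, div_lt_one (Real.exp_pos _)]
    linarith
  exact (sq_lt_one_iff₀ (tailRate_nonneg z)).mp h3

open Finset in
/-- Below the unit circle the tail of the exponential series is compared termwise with that at
modulus one, where the whole series has sum `e ^ N`. -/
theorem norm_exp_sub_sum_le (N : ℕ) {a : ℂ} (ha : ‖a‖ ≤ 1) :
    ‖Complex.exp (N * a) - ∑ l ∈ range N, ((N : ℂ) * a) ^ l / l.factorial‖ ≤
      ‖a‖ ^ N * Real.exp N := by
  have h1 : HasSum (fun l : ℕ => ((N : ℂ) * a) ^ l / l.factorial) (Complex.exp (N * a)) := by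
    rw [Complex.exp_eq_exp_ℂ]
    exact NormedSpace.expSeries_div_hasSum_exp _
  have h2 : HasSum (fun l : ℕ => (N : ℝ) ^ l / l.factorial) (Real.exp N) := by
    rw [Real.exp_eq_exp_ℝ]
    exact NormedSpace.expSeries_div_hasSum_exp _
  have h3 := (hasSum_nat_add_iff' N).mpr h1
  have h4 := (hasSum_nat_add_iff' N).mpr h2
  rw [← h3.tsum_eq]
  refine (tsum_of_norm_bounded (h4.mul_left (‖a‖ ^ N)) fun l => ?_).trans ?_
  · rw [norm_div, norm_pow, norm_mul, mul_pow, Complex.norm_natCast, Complex.norm_natCast,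
      mul_comm, mul_div_assoc]
    gcongr ?_ * _
    exact pow_le_pow_of_le_one (norm_nonneg _) ha (Nat.le_add_left N l)
  · gcongr
    have : 0 ≤ ∑ l ∈ range N, (N : ℝ) ^ l / l.factorial := by positivity
    linarith

open Finset in
/-- For `1 ≤ |a|` the truncated series itself satisfies the same bound: each power of `a` in it is
at most `|a| ^ N`, and what remains is a partial sum of the series of `e ^ N`. -/
theorem norm_sum_le_of_one_le (N : ℕ) {a : ℂ} (ha : 1 ≤ ‖a‖) :
    ‖∑ l ∈ range N, ((N : ℂ) * a) ^ l / l.factorial‖ ≤ ‖a‖ ^ N * Real.exp N := by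
  refine (norm_sum_le _ _).trans ?_
  calc _ ≤ ∑ l ∈ range N, ‖a‖ ^ N * ((N : ℝ) ^ l / l.factorial) := by
        refine sum_le_sum fun l hl => ?_
        rw [norm_div, norm_pow, norm_mul, mul_pow, Complex.norm_natCast, Complex.norm_natCast,
          mul_comm, mul_div_assoc]
        gcongr ?_ * _
        exact pow_le_pow_right₀ ha (mem_range.mp hl).le
    _ ≤ _ := by
        rw [← mul_sum]
        gcongr
        exact Real.sum_le_exp_of_nonneg (by positivity) N

/-- The Ginibre kernel divided by the number of particles. -/
def scaledKernel (N : ℕ) (z w : ℂ) : ℂ := ginibreKernel N z w / N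

/-- The scaled kernel is a truncated exponential series times a Gaussian weight. -/
theorem pi_mul_scaledKernel {N : ℕ} (hN : 0 < N) (z w : ℂ) :
    (Real.pi : ℂ) * scaledKernel N z w =
      (Real.exp (-(N : ℝ) * (‖z‖ ^ 2 + ‖w‖ ^ 2) / 2) : ℝ) *
        ∑ l ∈ Finset.range N, ((N : ℂ) * (z * star w)) ^ l / l.factorial := by
  have hN' : (N : ℂ) ≠ 0 := by exact_mod_cast hN.ne'
  have hpi : (Real.pi : ℂ) ≠ 0 := by exact_mod_cast Real.pi_ne_zero
  rw [scaledKernel, ginibreKernel, Fin.sum_univ_eq_sum_range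
    (fun l => orbital N l z * star (orbital N l w)), Finset.sum_div, Finset.mul_sum,
    Finset.mul_sum]
  refine Finset.sum_congr rfl fun l _ => ?_
  have he : Real.exp (-(N : ℝ) * (‖z‖ ^ 2 + ‖w‖ ^ 2) / 2) =
      Real.exp (-(N : ℝ) * ‖z‖ ^ 2 / 2) * Real.exp (-(N : ℝ) * ‖w‖ ^ 2 / 2) := by
    rw [← Real.exp_add]
    ring_nf
  have hs : ((√((N : ℝ) ^ (l + 1) / (Real.pi * l.factorial)) : ℝ) : ℂ) *
      (√((N : ℝ) ^ (l + 1) / (Real.pi * l.factorial)) : ℝ) =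
      (N : ℂ) ^ (l + 1) / (Real.pi * l.factorial) := by
    rw [← Complex.ofReal_mul, Real.mul_self_sqrt (by positivity)]
    push_cast
    rfl
  have hl : (l.factorial : ℂ) ≠ 0 := by exact_mod_cast l.factorial_ne_zero
  simp only [orbital, star_mul', star_pow, Complex.star_def, Complex.conj_ofReal]
  calc _ = (Real.pi : ℂ) * (((√((N : ℝ) ^ (l + 1) / (Real.pi * l.factorial)) : ℝ) : ℂ) *
      (√((N : ℝ) ^ (l + 1) / (Real.pi * l.factorial)) : ℝ)) *
      (Real.exp (-(N : ℝ) * ‖z‖ ^ 2 / 2) : ℝ) * (Real.exp (-(N : ℝ) * ‖w‖ ^ 2 / 2) : ℝ) *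
      (z ^ l * (starRingEnd ℂ) w ^ l) / N := by push_cast; ring
    _ = _ := by
      rw [hs, he]
      push_cast
      field_simp
      ring

/-- The Gaussian weight turns the bound `|z w̄|^N e^N` into a product of tail rates. -/
theorem exp_mul_pow_eq_tailRate (N : ℕ) (z w : ℂ) :
    Real.exp (-(N : ℝ) * (‖z‖ ^ 2 + ‖w‖ ^ 2) / 2) * (‖z * star w‖ ^ N * Real.exp N) =
      (tailRate z * tailRate w) ^ N := by
  have : Real.exp (-(N : ℝ) * (‖z‖ ^ 2 + ‖w‖ ^ 2) / 2) * Real.exp N =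
      (Real.exp ((1 - ‖z‖ ^ 2) / 2) * Real.exp ((1 - ‖w‖ ^ 2) / 2)) ^ N := by
    rw [← Real.exp_add, ← Real.exp_add, ← Real.exp_nat_mul]
    congr 1
    ring
  rw [tailRate, tailRate, norm_mul, norm_star, mul_mul_mul_comm,
    mul_pow (‖z‖ * ‖w‖), ← this]
  ring

theorem norm_pi_mul_scaledKernel_sub_le {N : ℕ} (hN : 0 < N) {z w : ℂ} (h : ‖z * star w‖ ≤ 1) :
    ‖(Real.pi : ℂ) * scaledKernel N z w -
      (Real.exp (-(N : ℝ) * (‖z‖ ^ 2 + ‖w‖ ^ 2) / 2) : ℝ) *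
        Complex.exp (N * (z * star w))‖ ≤ (tailRate z * tailRate w) ^ N := by
  rw [pi_mul_scaledKernel hN, ← mul_sub, norm_mul, norm_sub_rev, Complex.norm_real,
    Real.norm_eq_abs, Real.abs_exp, ← exp_mul_pow_eq_tailRate]
  gcongr
  exact norm_exp_sub_sum_le N h

theorem norm_pi_mul_scaledKernel_le_of_one_le {N : ℕ} (hN : 0 < N) {z w : ℂ}
    (h : 1 ≤ ‖z * star w‖) :
    ‖(Real.pi : ℂ) * scaledKernel N z w‖ ≤ (tailRate z * tailRate w) ^ N := by
  rw [pi_mul_scaledKernel hN, norm_mul, Complex.norm_real,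
    Real.norm_eq_abs, Real.abs_exp, ← exp_mul_pow_eq_tailRate]
  gcongr
  exact norm_sum_le_of_one_le N h

/-- Off the diagonal the scaled kernel decays exponentially. -/
theorem norm_scaledKernel_le {N : ℕ} (hN : 0 < N) (z w : ℂ) :
    ‖scaledKernel N z w‖ ≤ Real.exp (-‖z - w‖ ^ 2 / 2) ^ N + (tailRate z * tailRate w) ^ N := by
  have h0 : ‖scaledKernel N z w‖ ≤ ‖(Real.pi : ℂ) * scaledKernel N z w‖ := by
    rw [norm_mul, Complex.norm_real, Real.norm_eq_abs, abs_of_pos Real.pi_pos]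
    exact le_mul_of_one_le_left (norm_nonneg _) (by linarith [Real.pi_gt_three])
  refine h0.trans ?_
  rcases le_total ‖z * star w‖ 1 with h | h
  · have h1 := norm_pi_mul_scaledKernel_sub_le hN h
    have h2 : ‖((Real.exp (-(N : ℝ) * (‖z‖ ^ 2 + ‖w‖ ^ 2) / 2) : ℝ) : ℂ) *
        Complex.exp (N * (z * star w))‖ = Real.exp (-‖z - w‖ ^ 2 / 2) ^ N := by
      rw [norm_mul, Complex.norm_real, Real.norm_eq_abs, Real.abs_exp, Complex.norm_exp,
        ← Real.exp_add, ← Real.exp_nat_mul]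
      congr 1
      have h3 : ((N : ℂ) * (z * star w)).re = N * (z * star w).re := by
        rw [← Complex.ofReal_natCast, Complex.re_ofReal_mul]
      rw [h3, ← Complex.normSq_eq_norm_sq, ← Complex.normSq_eq_norm_sq,
        ← Complex.normSq_eq_norm_sq, Complex.normSq_sub]
      simp only [Complex.star_def]
      ring
    rw [← h2, add_comm]
    exact (norm_le_norm_sub_add _ _).trans (by gcongr)
  · exact (norm_pi_mul_scaledKernel_le_of_one_le hN h).trans (le_add_of_nonneg_left (by positivity))

/-- On the diagonal the scaled kernel converges to the density of the uniform law on the disc,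
exponentially fast. -/
theorem norm_scaledKernel_self_sub_le {N : ℕ} (hN : 0 < N) (z : ℂ) :
    ‖scaledKernel N z z - discDensity z‖ ≤ (tailRate z * tailRate z) ^ N := by
  have hpi : (Real.pi : ℂ) ≠ 0 := by exact_mod_cast Real.pi_ne_zero
  have h0 : ‖scaledKernel N z z - discDensity z‖ ≤
      ‖(Real.pi : ℂ) * scaledKernel N z z - Real.pi * discDensity z‖ := by
    rw [← mul_sub, norm_mul, Complex.norm_real, Real.norm_eq_abs, abs_of_pos Real.pi_pos]
    exact le_mul_of_one_le_left (norm_nonneg _) (by linarith [Real.pi_gt_three])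
  refine h0.trans ?_
  have hn : ‖z * star z‖ = ‖z‖ ^ 2 := by rw [norm_mul, norm_star, sq]
  rcases le_or_gt ‖z‖ 1 with h | h
  · rw [discDensity, Set.indicator_of_mem (by simpa using h)]
    convert norm_pi_mul_scaledKernel_sub_le hN (z := z) (w := z)
      (hn.trans_le (pow_le_one₀ (norm_nonneg _) h)) using 2
    congr 1
    rw [Complex.star_def, Complex.mul_conj, Complex.normSq_eq_norm_sq, Complex.ofReal_exp,
      ← Complex.exp_add, Complex.ofReal_inv, mul_inv_cancel₀ hpi]
    have he : (((-(N : ℝ) * (‖z‖ ^ 2 + ‖z‖ ^ 2) / 2 : ℝ) : ℂ) + N * ((‖z‖ ^ 2 : ℝ) : ℂ)) = 0 := by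
      push_cast
      ring
    rw [he, Complex.exp_zero]
  · rw [discDensity, Set.indicator_of_notMem (by simpa using h)]
    simp only [Complex.ofReal_zero, mul_zero, sub_zero]
    exact norm_pi_mul_scaledKernel_le_of_one_le hN (hn.symm ▸ one_le_pow₀ h.le)

/-! ### The limit law -/

theorem discDensity_nonneg (z : ℂ) : 0 ≤ discDensity z :=
  Set.indicator_nonneg (fun _ _ => by positivity) z

theorem discDensity_le_one (z : ℂ) : discDensity z ≤ 1 :=
  Set.indicator_le_self' (s := Metric.closedBall (0 : ℂ) 1) (f := fun _ => Real.pi⁻¹)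
    (fun _ _ => by positivity) z |>.trans (inv_le_one_of_one_le₀ (by linarith [Real.pi_gt_three]))

@[fun_prop]
theorem measurable_discDensity : Measurable discDensity :=
  measurable_const.indicator measurableSet_closedBall

theorem integrable_discDensity : Integrable discDensity :=
  (integrable_indicator_iff measurableSet_closedBall).mpr
    (integrableOn_const (measure_closedBall_lt_top.ne))

theorem integral_discDensity : ∫ z, discDensity z = 1 := by
  rw [discDensity, integral_indicator measurableSet_closedBall, setIntegral_const,
    measureReal_def, Complex.volume_closedBall]
  simp [Real.pi_ne_zero]

instance : SigmaFinite discLaw := by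
  unfold discLaw
  infer_instance

/-- The product of the disc laws has the product density. -/
theorem pi_discLaw (k : ℕ) : (Measure.pi fun _ : Fin k => discLaw) =
    volume.withDensity fun z => ENNReal.ofReal (∏ i, discDensity (z i)) := by
  refine Measure.pi_eq fun s hs => ?_
  rw [withDensity_apply _ (.univ_pi hs), volume_pi, Measure.restrict_pi_pi,
    ← ofReal_integral_eq_lintegral_ofReal, integral_fintype_prod_eq_prod,
    ENNReal.ofReal_prod_of_nonneg fun i _ => integral_nonneg discDensity_nonneg]
  · refine Finset.prod_congr rfl fun i _ => ?_
    rw [discLaw, withDensity_apply _ (hs i), ofReal_integral_eq_lintegral_ofReal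
      integrable_discDensity.integrableOn (.of_forall discDensity_nonneg)]
  · exact Integrable.fintype_prod fun i => integrable_discDensity.integrableOn
  · exact .of_forall fun z => Finset.prod_nonneg fun i _ => discDensity_nonneg _

theorem correlation_div_pow {N : ℕ} (hN : 0 < N) {k : ℕ} (z : Fin k → ℂ) :
    correlation N k z / (N : ℝ) ^ k = (kernelMatrix (scaledKernel N) z).det.re := by
  have hN' : (N : ℂ) ≠ 0 := by exact_mod_cast hN.ne'
  have h : kernelMatrix (ginibreKernel N) z = (N : ℂ) • kernelMatrix (scaledKernel N) z := by
    ext i j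
    simp only [kernelMatrix, Matrix.of_apply, Matrix.smul_apply, scaledKernel, smul_eq_mul]
    field_simp
  rw [correlation, h, Matrix.det_smul, Fintype.card_fin, ← Complex.ofReal_natCast,
    ← Complex.ofReal_pow, Complex.re_ofReal_mul, mul_div_cancel_left₀]
  positivity

open Filter Topology

theorem tendsto_scaledKernel {z w : ℂ} (hz : ‖z‖ ≠ 1) (hw : ‖w‖ ≠ 1) (hzw : z ≠ w) :
    Tendsto (fun N => scaledKernel N z w) atTop (𝓝 0) := by
  rw [tendsto_zero_iff_norm_tendsto_zero]
  have h1 : Tendsto (fun N : ℕ => Real.exp (-‖z - w‖ ^ 2 / 2) ^ N) atTop (𝓝 0) := by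
    refine tendsto_pow_atTop_nhds_zero_of_lt_one (Real.exp_pos _).le (Real.exp_lt_one_iff.mpr ?_)
    have := norm_pos_iff.mpr (sub_ne_zero.mpr hzw)
    have : 0 < ‖z - w‖ ^ 2 := by positivity
    linarith
  have h2 : Tendsto (fun N : ℕ => (tailRate z * tailRate w) ^ N) atTop (𝓝 0) :=
    tendsto_pow_atTop_nhds_zero_of_lt_one (mul_nonneg (tailRate_nonneg z) (tailRate_nonneg w))
      (mul_lt_one_of_nonneg_of_lt_one_left (tailRate_nonneg z) (tailRate_lt_one hz)
        (tailRate_lt_one hw).le)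
  refine squeeze_zero' (.of_forall fun _ => norm_nonneg _) ?_ (by simpa using h1.add h2)
  filter_upwards [eventually_gt_atTop 0] with N hN using norm_scaledKernel_le hN z w

theorem tendsto_scaledKernel_self {z : ℂ} (hz : ‖z‖ ≠ 1) :
    Tendsto (fun N => scaledKernel N z z) atTop (𝓝 (discDensity z)) := by
  rw [tendsto_iff_norm_sub_tendsto_zero]
  refine squeeze_zero' (.of_forall fun _ => norm_nonneg _) ?_
    (tendsto_pow_atTop_nhds_zero_of_lt_one
      (mul_nonneg (tailRate_nonneg z) (tailRate_nonneg z))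
      (mul_lt_one_of_nonneg_of_lt_one_left (tailRate_nonneg z) (tailRate_lt_one hz)
        (tailRate_lt_one hz).le))
  filter_upwards [eventually_gt_atTop 0] with N hN using norm_scaledKernel_self_sub_le hN z

/-- Off the unit circle and off the diagonals the correlation matrix becomes diagonal, so that the
particles become independent. -/
theorem tendsto_marginalDensity {k : ℕ} {z : Fin k → ℂ} (hz : ∀ i, ‖z i‖ ≠ 1)
    (hz' : ∀ i j, i ≠ j → z i ≠ z j) :
    Tendsto (fun N : ℕ => marginalDensity k N ((N : ℝ) ^ 2) z) atTop
      (𝓝 (∏ i, discDensity (z i))) := by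
  have h1 : Tendsto (fun N => kernelMatrix (scaledKernel N) z) atTop
      (𝓝 (Matrix.diagonal fun i => (discDensity (z i) : ℂ))) := by
    refine tendsto_pi_nhds.mpr fun i => tendsto_pi_nhds.mpr fun j => ?_
    by_cases hij : i = j
    · subst hij
      simpa [kernelMatrix] using tendsto_scaledKernel_self (hz i)
    · simpa [kernelMatrix, hij] using tendsto_scaledKernel (hz i) (hz j) (hz' i j hij)
  have h2 : Tendsto (fun N => (kernelMatrix (scaledKernel N) z).det.re) atTop
      (𝓝 (∏ i, discDensity (z i))) := by
    have h3 := (Complex.continuous_re.comp (continuous_id.matrix_det (n := Fin k) (R := ℂ))).tendsto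
      (Matrix.diagonal fun i => (discDensity (z i) : ℂ))
    have h4 := h3.comp h1
    simp only [Function.comp_apply, id, Matrix.det_diagonal, ← Complex.ofReal_prod,
      Complex.ofReal_re] at h4
    exact h4
  have h5 : Tendsto (fun N : ℕ => (N : ℝ) ^ k / N.descFactorial k) atTop (𝓝 1) := by
    refine (Asymptotics.isEquivalent_iff_tendsto_one ?_).mp (isEquivalent_descFactorial k).symm
    filter_upwards [eventually_ge_atTop k] with N hN
    have : 0 < N.descFactorial k := Nat.pos_of_ne_zero (by
      rw [Ne, Nat.descFactorial_eq_zero_iff_lt]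
      omega)
    exact_mod_cast this.ne'
  have h6 := h5.mul h2
  rw [one_mul] at h6
  refine h6.congr' ?_
  filter_upwards [eventually_ge_atTop k, eventually_gt_atTop 0] with N hk hN
  have : (N : ℝ) ^ k ≠ 0 := by positivity
  rw [marginalDensity_eq hN hk, ← correlation_div_pow hN]
  field_simp

theorem ae_norm_ne_one_and_pairwise_ne (k : ℕ) :
    ∀ᵐ z : Fin k → ℂ, (∀ i, ‖z i‖ ≠ 1) ∧ ∀ i j, i ≠ j → z i ≠ z j := by
  rw [eventually_and, eventually_all]
  refine ⟨fun i => ?_, ?_⟩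
  · have h : ∀ᵐ z : ℂ, ‖z‖ ≠ 1 := by
      rw [ae_iff]
      simpa [Metric.sphere, dist_zero_right] using
        Measure.addHaar_sphere (volume : Measure ℂ) 0 1
    exact (Measure.quasiMeasurePreserving_eval (fun _ : Fin k => (volume : Measure ℂ)) i).ae h
  · simp only [eventually_all]
    intro i j hij
    rw [ae_iff]
    simp only [ne_eq, not_not]
    -- the diagonal `z i = z j` is a proper real subspace
    have h := Measure.addHaar_submodule (volume : Measure (Fin k → ℂ))
      (LinearMap.ker ((LinearMap.proj i : (Fin k → ℂ) →ₗ[ℝ] ℂ) - LinearMap.proj j)) (fun h => by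
        have h1 := LinearMap.congr_fun (LinearMap.ker_eq_top.mp h) (Pi.single i 1)
        simp [hij.symm] at h1)
    convert h using 2
    ext z
    simp [sub_eq_zero]

/-- Scheffé's lemma, in the form needed for bounded test functions: almost everywhere convergence
of nonnegative densities with convergent total mass implies convergence in `L¹`. -/
theorem tendsto_integral_mul_of_ae_tendsto {α : Type*} [MeasurableSpace α] {μ : Measure α}
    {F : ℕ → α → ℝ} {G : α → ℝ} (hF : ∀ᶠ n in atTop, Integrable (F n) μ)
    (hF0 : ∀ᶠ n in atTop, ∀ x, 0 ≤ F n x) (hG : Integrable G μ) (hG0 : ∀ x, 0 ≤ G x)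
    (hI : Tendsto (fun n => ∫ x, F n x ∂μ) atTop (𝓝 (∫ x, G x ∂μ)))
    (hae : ∀ᵐ x ∂μ, Tendsto (fun n => F n x) atTop (𝓝 (G x)))
    {f : α → ℝ} (hf : AEStronglyMeasurable f μ) {C : ℝ} (hC : ∀ x, |f x| ≤ C) :
    Tendsto (fun n => ∫ x, F n x * f x ∂μ) atTop (𝓝 (∫ x, G x * f x ∂μ)) := by
  -- the positive part of `G - F n` is dominated by `G`
  have hpos : Tendsto (fun n => ∫ x, max (G x - F n x) 0 ∂μ) atTop (𝓝 (∫ _, (0 : ℝ) ∂μ)) := by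
    refine tendsto_integral_filter_of_dominated_convergence G ?_ ?_ hG ?_
    · filter_upwards [hF] with n hn using (hG.sub hn).pos_part.aestronglyMeasurable
    · filter_upwards [hF0] with n hn
      refine .of_forall fun x => ?_
      rw [Real.norm_eq_abs, abs_of_nonneg (le_max_right _ _)]
      exact max_le (by linarith [hn x]) (hG0 x)
    · filter_upwards [hae] with x hx
      simpa using (hx.const_sub (G x)).max (tendsto_const_nhds (x := (0 : ℝ)))
  have hL1 : Tendsto (fun n => ∫ x, |F n x - G x| ∂μ) atTop (𝓝 0) := by
    -- `|F - G| = (F - G) + 2 (G - F)⁺`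
    have h := (hI.sub_const (∫ x, G x ∂μ)).add (hpos.const_mul 2)
    simp only [sub_self, integral_zero, mul_zero, add_zero] at h
    refine h.congr' ?_
    filter_upwards [hF] with n hn
    have hp : Integrable (fun x => max (G x - F n x) 0) μ := (hG.sub hn).pos_part
    have hd : Integrable (fun x => F n x - G x) μ := hn.sub hG
    rw [← integral_sub hn hG, ← integral_const_mul, ← integral_add hd (hp.const_mul 2)]
    refine integral_congr_ae (.of_forall fun x => ?_)
    dsimp only
    rcases le_total (F n x) (G x) with h | h
    · rw [max_eq_left (by linarith), abs_of_nonpos (by linarith)]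
      ring
    · rw [max_eq_right (by linarith), abs_of_nonneg (by linarith)]
      ring
  rw [tendsto_iff_norm_sub_tendsto_zero]
  refine squeeze_zero' (.of_forall fun _ => norm_nonneg _) ?_
    (by simpa using hL1.const_mul C)
  filter_upwards [hF] with n hn
  have hb : ∀ᵐ x ∂μ, ‖f x‖ ≤ C := .of_forall hC
  rw [← integral_sub (hn.mul_bdd hf hb) (hG.mul_bdd hf hb), ← integral_const_mul]
  refine norm_integral_le_of_norm_le ((hn.sub hG).abs.const_mul C) (.of_forall fun x => ?_)
  rw [← sub_mul, norm_mul, mul_comm, Real.norm_eq_abs, Real.norm_eq_abs]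
  exact mul_le_mul_of_nonneg_right (hC x) (abs_nonneg _)

theorem tendsto_integral_marginal (k : ℕ) (f : BoundedContinuousFunction (Fin k → ℂ) ℝ) :
    Tendsto (fun N : ℕ => ∫ x, f x ∂(marginal k N ((N : ℝ) ^ 2))) atTop
      (𝓝 (∫ x, f x ∂(Measure.pi fun _ : Fin k => discLaw))) := by
  have hm : Measurable fun z : Fin k → ℂ => ∏ i, discDensity (z i) := by fun_prop
  have hprod0 : ∀ z : Fin k → ℂ, 0 ≤ ∏ i, discDensity (z i) := fun z =>
    Finset.prod_nonneg fun i _ => discDensity_nonneg _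
  have hGint : Integrable fun z : Fin k → ℂ => ∏ i, discDensity (z i) :=
    Integrable.fintype_prod fun _ => integrable_discDensity
  have hG1 : ∫ z : Fin k → ℂ, ∏ i, discDensity (z i) = 1 := by
    rw [integral_fintype_prod_volume_eq_prod]
    simp [integral_discDensity]
  have hnn : ∀ {N : ℕ}, 0 < N → k ≤ N → ∀ z, 0 ≤ marginalDensity k N ((N : ℝ) ^ 2) z := by
    intro N hN hk z
    rw [marginalDensity_eq hN hk]
    exact div_nonneg (correlation_nonneg N z) (by positivity)
  have key := tendsto_integral_mul_of_ae_tendsto (μ := volume)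
    (F := fun N : ℕ => marginalDensity k N ((N : ℝ) ^ 2))
    (G := fun z => ∏ i, discDensity (z i)) (f := f) (C := ‖f‖) ?_ ?_ hGint hprod0 ?_ ?_
    f.continuous.aestronglyMeasurable f.norm_coe_le_norm
  · rw [pi_discLaw, integral_withDensity_eq_integral_toReal_smul hm.ennreal_ofReal
      (.of_forall fun _ => ENNReal.ofReal_lt_top)]
    simp_rw [ENNReal.toReal_ofReal (hprod0 _), smul_eq_mul]
    refine key.congr' ?_
    filter_upwards [eventually_ge_atTop k, eventually_gt_atTop 0] with N hk hN
    have hmeas : Measurable (marginalDensity k N ((N : ℝ) ^ 2)) := by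
      rw [funext (marginalDensity_eq hN hk)]
      fun_prop
    rw [marginal_eq_withDensity hN hk, integral_withDensity_eq_integral_toReal_smul
      hmeas.ennreal_ofReal (.of_forall fun _ => ENNReal.ofReal_lt_top)]
    simp_rw [ENNReal.toReal_ofReal (hnn hN hk _), smul_eq_mul]
  · filter_upwards [eventually_ge_atTop k, eventually_gt_atTop 0] with N hk hN
    rw [funext (marginalDensity_eq hN hk)]
    exact (integrable_correlation hN hk).div_const _
  · filter_upwards [eventually_ge_atTop k, eventually_gt_atTop 0] with N hk hN using hnn hN hk
  · rw [hG1]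
    refine tendsto_const_nhds.congr' ?_
    filter_upwards [eventually_ge_atTop k, eventually_gt_atTop 0] with N hk hN
    rw [funext (marginalDensity_eq hN hk), integral_div, integral_correlation hN hk, div_self]
    have : N.descFactorial k ≠ 0 := by
      rw [Ne, Nat.descFactorial_eq_zero_iff_lt]
      omega
    exact_mod_cast this
  · filter_upwards [ae_norm_ne_one_and_pairwise_ne k] with z hz
    exact tendsto_marginalDensity hz.1 hz.2

theorem marginalDensity_one {N : ℕ} (hN : 0 < N) (z : ℂ) :
    marginalDensity 1 N ((N : ℝ) ^ 2) ![z] = (scaledKernel N z z).re := by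
  have h := correlation_div_pow hN ![z]
  rw [marginalDensity_eq hN hN, Nat.descFactorial_one, ← pow_one (N : ℝ), h]
  simp [kernelMatrix]

theorem abs_marginalDensity_one_sub_le {N : ℕ} (hN : 0 < N) (z : ℂ) :
    |marginalDensity 1 N ((N : ℝ) ^ 2) ![z] - discDensity z| ≤ (tailRate z * tailRate z) ^ N := by
  rw [marginalDensity_one hN, ← Complex.ofReal_re (discDensity z), ← Complex.sub_re]
  exact (Complex.abs_re_le_norm _).trans (norm_scaledKernel_self_sub_le hN z)

theorem star_scaledKernel (N : ℕ) (z w : ℂ) :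
    star (scaledKernel N z w) = scaledKernel N w z := by
  simp [scaledKernel, ginibreKernel, mul_comm]

theorem marginalDensity_two {N : ℕ} (hN : 2 ≤ N) (z w : ℂ) :
    marginalDensity 2 N ((N : ℝ) ^ 2) ![z, w] = N / (N - 1) *
      ((scaledKernel N z z).re * (scaledKernel N w w).re - ‖scaledKernel N z w‖ ^ 2) := by
  have hN0 : 0 < N := by omega
  have him : ∀ z, (scaledKernel N z z).im = 0 := fun z =>
    Complex.conj_eq_iff_im.mp (star_scaledKernel N z z)
  have h := correlation_div_pow hN0 ![z, w]
  have h1 : (1 : ℝ) < N := by exact_mod_cast hN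
  have h2 : (N : ℝ) - 1 ≠ 0 := by linarith
  have h3 : (kernelMatrix (scaledKernel N) ![z, w]).det.re =
      (scaledKernel N z z).re * (scaledKernel N w w).re - ‖scaledKernel N z w‖ ^ 2 := by
    rw [Matrix.det_fin_two]
    simp only [kernelMatrix, Matrix.of_apply, Matrix.cons_val_zero, Matrix.cons_val_one,
      Complex.sub_re]
    rw [← star_scaledKernel N z w, Complex.star_def, Complex.mul_conj, Complex.normSq_eq_norm_sq,
      Complex.ofReal_re, Complex.mul_re, him, zero_mul, sub_zero]
  rw [marginalDensity_eq hN0 hN, Nat.cast_descFactorial_two, ← h3, ← h]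
  field_simp

/-- The error `1 / (N - 1)` comes from the prefactor `N / (N - 1)`; the exponentially small one
from the kernel on and off the diagonal. -/
theorem abs_marginalDensity_two_sub_le {N : ℕ} (hN : 2 ≤ N) {z w : ℂ} {q : ℝ}
    (hz : tailRate z * tailRate z ≤ q) (hw : tailRate w * tailRate w ≤ q)
    (hzw : tailRate z * tailRate w ≤ q) (he : Real.exp (-‖z - w‖ ^ 2 / 2) ≤ q) (hq : q ≤ 1) :
    |marginalDensity 2 N ((N : ℝ) ^ 2) ![z, w] - discDensity z * discDensity w| ≤
      14 * q ^ N + 1 / ((N : ℝ) - 1) := by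
  have hN0 : 0 < N := by omega
  have hN2 : (2 : ℝ) ≤ N := by exact_mod_cast hN
  have hq0 : 0 ≤ q := (Real.exp_pos _).le.trans he
  have hqN : q ^ N ≤ 1 := pow_le_one₀ hq0 hq
  have hqN0 : 0 ≤ q ^ N := pow_nonneg hq0 N
  have ha : |(scaledKernel N z z).re - discDensity z| ≤ q ^ N := by
    rw [← marginalDensity_one hN0]
    exact (abs_marginalDensity_one_sub_le hN0 z).trans
      (pow_le_pow_left₀ (mul_self_nonneg _) hz N)
  have hb : |(scaledKernel N w w).re - discDensity w| ≤ q ^ N := by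
    rw [← marginalDensity_one hN0]
    exact (abs_marginalDensity_one_sub_le hN0 w).trans
      (pow_le_pow_left₀ (mul_self_nonneg _) hw N)
  have hc : ‖scaledKernel N z w‖ ≤ 2 * q ^ N := by
    have h1 := pow_le_pow_left₀ (Real.exp_pos _).le he N
    have h2 := pow_le_pow_left₀ (mul_nonneg (tailRate_nonneg z) (tailRate_nonneg w)) hzw N
    linarith [norm_scaledKernel_le hN0 z w]
  have hc2 : ‖scaledKernel N z w‖ ^ 2 ≤ 4 * q ^ N := by
    nlinarith [norm_nonneg (scaledKernel N z w)]
  have hc0 : 0 ≤ ‖scaledKernel N z w‖ ^ 2 := sq_nonneg _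
  have hdz := discDensity_nonneg z
  have hdz1 := discDensity_le_one z
  have hdw := discDensity_nonneg w
  have hdw1 := discDensity_le_one w
  rw [marginalDensity_two hN]
  generalize (scaledKernel N z z).re = a at ha ⊢
  generalize (scaledKernel N w w).re = b at hb ⊢
  generalize ‖scaledKernel N z w‖ ^ 2 = c at hc2 hc0 ⊢
  generalize discDensity z = d at *
  generalize discDensity w = d' at *
  generalize q ^ N = t at *
  set r : ℝ := 1 / ((N : ℝ) - 1) with hr
  have hr0 : 0 ≤ r := by
    rw [hr]
    exact div_nonneg zero_le_one (by linarith)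
  have hr1 : r ≤ 1 := by
    rw [hr, div_le_one (by linarith)]
    linarith
  have hNr : (N : ℝ) / (N - 1) = 1 + r := by
    rw [hr]
    have : (N : ℝ) - 1 ≠ 0 := by linarith
    field_simp
    ring
  have hbabs : |b| ≤ 2 := by
    rw [abs_le] at hb ⊢
    constructor <;> linarith
  have hX : |a * b - c - d * d'| ≤ 7 * t := by
    have h1 : |(a - d) * b| ≤ t * 2 := by
      rw [abs_mul]
      exact mul_le_mul ha hbabs (abs_nonneg _) hqN0
    have h2 : |d * (b - d')| ≤ 1 * t := by
      rw [abs_mul, abs_of_nonneg hdz]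
      exact mul_le_mul hdz1 hb (abs_nonneg _) zero_le_one
    rw [abs_le] at h1 h2 ⊢
    constructor <;> linarith
  have h3 : |(1 + r) * (a * b - c - d * d')| ≤ 2 * (7 * t) := by
    rw [abs_mul, abs_of_nonneg (by linarith)]
    exact mul_le_mul (by linarith) hX (abs_nonneg _) zero_le_two
  have h4 : |r * (d * d')| ≤ r := by
    rw [abs_of_nonneg (by positivity)]
    exact mul_le_of_le_one_right hr0 (mul_le_one₀ hdz1 hdw hdw1)
  rw [hNr]
  calc |(1 + r) * (a * b - c) - d * d'| = |(1 + r) * (a * b - c - d * d') + r * (d * d')| := by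
        ring_nf
    _ ≤ 2 * (7 * t) + r := (abs_add_le _ _).trans (add_le_add h3 h4)
    _ = 14 * t + r := by ring

theorem exists_lt_one_forall_le {X : Type*} [TopologicalSpace X] {K : Set X} (hK : IsCompact K)
    {f : X → ℝ} (hf : Continuous f) (h0 : ∀ x ∈ K, 0 ≤ f x) (h1 : ∀ x ∈ K, f x < 1) :
    ∃ q : ℝ, 0 ≤ q ∧ q < 1 ∧ ∀ x ∈ K, f x ≤ q := by
  rcases K.eq_empty_or_nonempty with rfl | hne
  · exact ⟨0, le_rfl, one_pos, by simp⟩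
  · obtain ⟨x, hx, hmax⟩ := hK.exists_isMaxOn hne hf.continuousOn
    exact ⟨f x, h0 x hx, h1 x hx, fun y hy => hmax hy⟩

theorem tendstoUniformlyOn_of_abs_sub_le {X : Type*} {F : ℕ → X → ℝ} {G : X → ℝ} {K : Set X}
    {u : ℕ → ℝ} (hu : Tendsto u atTop (𝓝 0))
    (h : ∀ᶠ N in atTop, ∀ x ∈ K, |F N x - G x| ≤ u N) : TendstoUniformlyOn F G atTop K := by
  rw [Metric.tendstoUniformlyOn_iff]
  intro ε hε
  filter_upwards [h, hu.eventually (gt_mem_nhds hε)] with N h1 h2 x hx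
  rw [dist_comm, Real.dist_eq]
  exact (h1 x hx).trans_lt h2

theorem tendstoUniformlyOn_marginalDensity_one {K : Set ℂ} (hK : IsCompact K)
    (hK' : K ⊆ {z : ℂ | ‖z‖ ≠ 1}) :
    TendstoUniformlyOn (fun (N : ℕ) (z : ℂ) => marginalDensity 1 N ((N : ℝ) ^ 2) ![z])
      discDensity atTop K := by
  obtain ⟨q, hq0, hq1, hq⟩ := exists_lt_one_forall_le hK
    (f := fun z => tailRate z * tailRate z) (by fun_prop) (fun z _ => mul_self_nonneg _)
    (fun z hz => mul_lt_one_of_nonneg_of_lt_one_left (tailRate_nonneg z)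
      (tailRate_lt_one (hK' hz)) (tailRate_lt_one (hK' hz)).le)
  refine tendstoUniformlyOn_of_abs_sub_le (tendsto_pow_atTop_nhds_zero_of_lt_one hq0 hq1) ?_
  filter_upwards [eventually_gt_atTop 0] with N hN z hz
  exact (abs_marginalDensity_one_sub_le hN z).trans
    (pow_le_pow_left₀ (mul_self_nonneg _) (hq z hz) N)

theorem tendstoUniformlyOn_marginalDensity_two {K : Set (ℂ × ℂ)} (hK : IsCompact K)
    (hK' : K ⊆ {p : ℂ × ℂ | ‖p.1‖ ≠ 1 ∧ ‖p.2‖ ≠ 1 ∧ p.1 ≠ p.2}) :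
    TendstoUniformlyOn
      (fun (N : ℕ) (p : ℂ × ℂ) => marginalDensity 2 N ((N : ℝ) ^ 2) ![p.1, p.2])
      (fun p => discDensity p.1 * discDensity p.2) atTop K := by
  have hlt : ∀ {z w : ℂ}, ‖z‖ ≠ 1 → ‖w‖ ≠ 1 → tailRate z * tailRate w < 1 := fun hz hw =>
    mul_lt_one_of_nonneg_of_lt_one_left (tailRate_nonneg _) (tailRate_lt_one hz)
      (tailRate_lt_one hw).le
  obtain ⟨q, hq0, hq1, hq⟩ := exists_lt_one_forall_le hK
    (f := fun p => max (max (tailRate p.1 * tailRate p.1) (tailRate p.2 * tailRate p.2))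
      (max (tailRate p.1 * tailRate p.2) (Real.exp (-‖p.1 - p.2‖ ^ 2 / 2)))) (by fun_prop)
    (fun p _ => le_max_of_le_right (le_max_of_le_right (Real.exp_pos _).le))
    (fun p hp => by
      obtain ⟨h1, h2, h12⟩ := hK' hp
      refine max_lt (max_lt (hlt h1 h1) (hlt h2 h2)) (max_lt (hlt h1 h2) (Real.exp_lt_one_iff.mpr ?_))
      have := norm_pos_iff.mpr (sub_ne_zero.mpr h12)
      have : 0 < ‖p.1 - p.2‖ ^ 2 := by positivity
      linarith)
  have hu : Tendsto (fun N : ℕ => 14 * q ^ N + 1 / ((N : ℝ) - 1)) atTop (𝓝 0) := by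
    have h1 := (tendsto_pow_atTop_nhds_zero_of_lt_one hq0 hq1).const_mul 14
    have h2 : Tendsto (fun N : ℕ => 1 / ((N : ℝ) - 1)) atTop (𝓝 0) := by
      simp_rw [one_div]
      exact (tendsto_atTop_add_const_right _ (-1) tendsto_natCast_atTop_atTop).inv_tendsto_atTop
    simpa using h1.add h2
  refine tendstoUniformlyOn_of_abs_sub_le hu ?_
  filter_upwards [eventually_ge_atTop 2] with N hN p hp
  have h := hq p hp
  simp only [max_le_iff] at h
  exact abs_marginalDensity_two_sub_le hN h.1.1 h.1.2 h.2.1 h.2.2 hq1.le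

end CoulombGas

end

open Filter Topology CoulombGas in
theorem theorem1p5 :
    (∀ N : ℕ, 2 ≤ N → IsProbabilityMeasure (gibbs N ((N : ℝ) ^ 2))) ∧
    (∀ k N : ℕ, 1 ≤ k → 2 ≤ N → k ≤ N →
      marginal k N ((N : ℝ) ^ 2) =
        volume.withDensity fun z => ENNReal.ofReal (marginalDensity k N ((N : ℝ) ^ 2) z)) ∧
    (∀ k : ℕ, 1 ≤ k → ∀ f : BoundedContinuousFunction (Fin k → ℂ) ℝ,
      Tendsto (fun N : ℕ => ∫ x, f x ∂(marginal k N ((N : ℝ) ^ 2))) atTop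
        (𝓝 (∫ x, f x ∂(Measure.pi fun _ : Fin k => discLaw)))) ∧
    (∀ K : Set ℂ, IsCompact K → K ⊆ {z : ℂ | ‖z‖ ≠ 1} →
      TendstoUniformlyOn (fun (N : ℕ) (z : ℂ) => marginalDensity 1 N ((N : ℝ) ^ 2) ![z])
        discDensity atTop K) ∧
    (∀ K : Set (ℂ × ℂ), IsCompact K →
      K ⊆ {p : ℂ × ℂ | ‖p.1‖ ≠ 1 ∧ ‖p.2‖ ≠ 1 ∧ p.1 ≠ p.2} →
      TendstoUniformlyOn
        (fun (N : ℕ) (p : ℂ × ℂ) => marginalDensity 2 N ((N : ℝ) ^ 2) ![p.1, p.2])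
        (fun p => discDensity p.1 * discDensity p.2) atTop K) := by
  refine ⟨fun N hN => isProbabilityMeasure_gibbs (by omega),
    fun k N _ hN hk => marginal_eq_withDensity (by omega) hk,
    fun k _ f => tendsto_integral_marginal k f,
    fun K hK hK' => tendstoUniformlyOn_marginalDensity_one hK hK',
    fun K hK hK' => tendstoUniformlyOn_marginalDensity_two hK hK'⟩
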